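/- Let $G$ be a finite connected simple graph and let $k\ge 1$ be an integer. The $k$-parallel subdivision graph $S_k(G)$ is obtained from $G$ by replacing each edge by $k$ parallel paths of length $2$; thus its vertex set is $V(G)\cup N$, where $N$ consists of $k$ new vertices for every edge $e$ of $G$, each of them adjacent exactly to the two ends of $e$. For a connected graph $H$, let $\Omega_{ij}(H)$ be the resistance distance between the vertices $i$ and $j$ of $H$, i.e. the effective resistance between $i$ and $j$ when every edge of $H$ is a unit resistor. Then: 1. If $i,j\in V(G)$, then $$\Omega_{ij}(S_k(G))=\frac{2}{k}\,\Omega_{ij}(G).$$ 2. If $i\in N$ has neighbourhood $\{s,t\}$ in $S_k(G)$ and $j\in V(G)$, then $$\Omega_{ij}(S_k(G))=\frac{k+2\Omega_{sj}(G)+2\Omega_{tj}(G)-\Omega_{st}(G)}{2k}.$$ 3. If $i,j\in N$ are distinct and have neighbourhoods $\{s,t\}$ and $\{p,q\}$, respectively, in $S_k(G)$, then $$\Omega_{ij}(S_k(G))=\frac{2k+\Omega_{sp}(G)+\Omega_{sq}(G)+\Omega_{tp}(G)+\Omega_{tq}(G)-\Omega_{pq}(G)-\Omega_{st}(G)}{2k}.$$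 -/

import Mathlib

open Classical in
/-- `φ` is an electric potential on the network obtained from `G` by replacing every edge with a
unit resistor, when a unit current enters at `i` and leaves at `j`: by Ohm's law the current along
an edge from `w` to `x` is `φ w - φ x`, and Kirchhoff's current law holds at every vertex. -/
def IsUnitCurrentPotential {V : Type*} [Fintype V] (G : SimpleGraph V) (i j : V) (φ : V → ℝ) :
    Prop :=
  ∀ w : V, (∑ x : V, if G.Adj w x then φ w - φ x else 0) =
    (if w = i then 1 else 0) - (if w = j then 1 else 0)

/-- `r` is the effective resistance between `i` and `j`: the potential difference between `i` and
`j` when a unit current flows from `i` to `j` and every edge is a unit resistor. -/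
def IsEffectiveResistance {V : Type*} [Fintype V] (G : SimpleGraph V) (i j : V) (r : ℝ) : Prop :=
  ∃ φ : V → ℝ, IsUnitCurrentPotential G i j φ ∧ r = φ i - φ j

open Classical in
/-- The resistance distance `Ω i j` of a finite graph. On a connected graph the effective
resistance exists and is unique (see `existsUnique_isEffectiveResistance`), so that the default
value `0` is never used there. -/
noncomputable def resistanceDist {V : Type*} [Fintype V] (G : SimpleGraph V) (i j : V) : ℝ :=
  if h : ∃ r : ℝ, IsEffectiveResistance G i j r then h.choose else 0

/-- The `k`-parallel subdivision graph `S_k(G)`: every edge of `G` is replaced by `k` parallel paths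
of length two. Its vertices are the original vertices `Sum.inl v` and, for every edge `e` of `G` and
every `l : Fin k`, a new vertex `Sum.inr (e, l)`, which is joined to the two ends of `e`. -/
def parallelSubdivision {V : Type*} (G : SimpleGraph V) (k : ℕ) :
    SimpleGraph (V ⊕ (G.edgeSet × Fin k)) where
  Adj
    | Sum.inl v, Sum.inr (e, _) => v ∈ (e : Sym2 V)
    | Sum.inr (e, _), Sum.inl v => v ∈ (e : Sym2 V)
    | Sum.inl _, Sum.inl _ => False
    | Sum.inr _, Sum.inr _ => False
  symm := ⟨by rintro (v | ⟨e, l⟩) (w | ⟨f, m⟩) h <;> exact h⟩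
  loopless := ⟨by rintro (v | ⟨e, l⟩) h <;> exact h⟩

open Classical in
theorem isUnitCurrentPotential_iff_lapMatrix {V : Type*} [Fintype V] (G : SimpleGraph V) (i j : V)
    (φ : V → ℝ) : IsUnitCurrentPotential G i j φ ↔
      (G.lapMatrix ℝ).mulVec φ = Pi.single i 1 - Pi.single j 1 := by
  rw [funext_iff]
  refine forall_congr' fun w => ?_
  have h : (∑ x : V, if G.Adj w x then φ w - φ x else 0) = (G.lapMatrix ℝ).mulVec φ w := by
    rw [SimpleGraph.lapMatrix_mulVec_apply, ← Finset.sum_filter, Finset.sum_sub_distrib,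
      ← SimpleGraph.neighborFinset_eq_filter]
    simp
  rw [h]
  simp [Pi.single_apply]

/-- On a finite connected graph the effective resistance between two vertices exists and is
unique. -/
theorem existsUnique_isEffectiveResistance {V : Type*} [Fintype V] (G : SimpleGraph V)
    (hG : G.Connected) (i j : V) : ∃! r : ℝ, IsEffectiveResistance G i j r := by
  classical
  have hsymm : ∀ x y : V → ℝ, x ⬝ᵥ (G.lapMatrix ℝ).mulVec y = (G.lapMatrix ℝ).mulVec x ⬝ᵥ y := by
    intro x y
    rw [Matrix.dotProduct_mulVec, ← Matrix.mulVec_transpose, (G.isSymm_lapMatrix (R := ℝ)).eq]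
  have hconst : ∀ x : V → ℝ, (G.lapMatrix ℝ).mulVec x = 0 → x i = x j := fun x hx =>
    (SimpleGraph.lapMatrix_mulVec_eq_zero_iff_forall_reachable G).1 hx i j (hG.preconnected i j)
  have hex : ∃ φ : V → ℝ, (G.lapMatrix ℝ).mulVec φ = Pi.single i 1 - Pi.single j 1 := by
    by_contra hne
    have hmem : (Pi.single i 1 - Pi.single j 1 : V → ℝ) ∉
        LinearMap.range (G.lapMatrix ℝ).mulVecLin := by
      rintro ⟨φ, hφ⟩
      exact hne ⟨φ, hφ⟩
    obtain ⟨f, hf, hle⟩ := Submodule.exists_le_ker_of_notMem hmem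
    obtain ⟨y, hy⟩ : ∃ y : V → ℝ, ∀ x, f x = y ⬝ᵥ x := by
      refine ⟨fun v => f (Pi.single v 1), fun x => ?_⟩
      conv_lhs => rw [pi_eq_sum_univ' x]
      simp only [map_sum, map_smul, smul_eq_mul, dotProduct]
      refine Finset.sum_congr rfl fun v _ => ?_
      rw [mul_comm]
    have hker : (G.lapMatrix ℝ).mulVec y = 0 := by
      refine dotProduct_eq_zero _ fun x => ?_
      rw [← hsymm, ← hy]
      exact hle ⟨x, rfl⟩
    apply hf
    rw [hy]
    simp [dotProduct_sub, hconst y hker]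
  obtain ⟨φ, hφ⟩ := hex
  refine ⟨φ i - φ j, ⟨φ, (isUnitCurrentPotential_iff_lapMatrix G i j φ).2 hφ, rfl⟩, ?_⟩
  rintro r ⟨ψ, hψ, rfl⟩
  rw [isUnitCurrentPotential_iff_lapMatrix] at hψ
  have h0 := hconst (ψ - φ) (by rw [Matrix.mulVec_sub, hψ, hφ, sub_self])
  simp only [Pi.sub_apply] at h0
  linarith

/-- On a finite connected graph, `resistanceDist` is the effective resistance. -/
theorem isEffectiveResistance_resistanceDist {V : Type*} [Fintype V] (G : SimpleGraph V)
    (hG : G.Connected) (i j : V) : IsEffectiveResistance G i j (resistanceDist G i j) := by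
  have h := (existsUnique_isEffectiveResistance G hG i j).exists
  rw [resistanceDist, dif_pos h]
  exact h.choose_spec

/-! Net current is linear in the potential, so potentials superpose. With a symmetric Green's
function `g` of `G` grounded at `o`, resistance is `g i i + g j j - 2 * g i j`; it remains to find
grounded potentials on the subdivision in terms of `g`. Extending a potential of `G` by averages
leaves no net current at new vertices, and `k` paths of resistance 2 in parallel conduct `k / 2`, so
`2 / k` times the extension serves an old source (`netCurrent_subdivisionExtend`). A unit source at
a new vertex is half a source at each end plus a spike of height `1 / 2` there
(`netCurrent_single_inr`). Subtracting two such potentials gives all three formulas. -/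

open Classical in
/-- The linear map sending a potential on the unit-resistor network `G` to the net current leaving
each vertex. -/
noncomputable def netCurrent {V : Type*} [Fintype V] (G : SimpleGraph V) :
    (V → ℝ) →ₗ[ℝ] (V → ℝ) :=
  (G.lapMatrix ℝ).mulVecLin

open Classical in
theorem netCurrent_apply {V : Type*} [Fintype V] (G : SimpleGraph V) (φ : V → ℝ) (w : V) :
    netCurrent G φ w = ∑ x : V, if G.Adj w x then φ w - φ x else 0 := by
  rw [netCurrent, Matrix.mulVecLin_apply, SimpleGraph.lapMatrix_mulVec_apply,
    ← Finset.sum_filter, Finset.sum_sub_distrib, ← SimpleGraph.neighborFinset_eq_filter]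
  simp

open Classical in
theorem isUnitCurrentPotential_iff_netCurrent {V : Type*} [Fintype V] (G : SimpleGraph V)
    (i j : V) (φ : V → ℝ) :
    IsUnitCurrentPotential G i j φ ↔ netCurrent G φ = Pi.single i 1 - Pi.single j 1 :=
  isUnitCurrentPotential_iff_lapMatrix G i j φ

/-- Reciprocity: the Laplacian is a symmetric matrix. This is the source of the symmetry of Green's
functions. -/
theorem dotProduct_netCurrent {V : Type*} [Fintype V] (G : SimpleGraph V) (x y : V → ℝ) :
    x ⬝ᵥ netCurrent G y = netCurrent G x ⬝ᵥ y := by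
  classical
  simp only [netCurrent, Matrix.mulVecLin_apply]
  rw [Matrix.dotProduct_mulVec, ← Matrix.mulVec_transpose, (G.isSymm_lapMatrix (R := ℝ)).eq]

theorem netCurrent_const {V : Type*} [Fintype V] (G : SimpleGraph V) (c : ℝ) :
    netCurrent G (fun _ => c) = 0 := by
  ext w
  simp [netCurrent_apply]

/-- On a connected graph, any potential whose net current is a unit current from `i` to `j`
computes the resistance distance. -/
theorem resistanceDist_eq_of_netCurrent {V : Type*} [Fintype V] [DecidableEq V]
    {G : SimpleGraph V} (hG : G.Connected) {i j : V} {φ : V → ℝ}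
    (h : netCurrent G φ = Pi.single i 1 - Pi.single j 1) :
    resistanceDist G i j = φ i - φ j := by
  refine (existsUnique_isEffectiveResistance G hG i j).unique
    (isEffectiveResistance_resistanceDist G hG i j)
    ⟨φ, (isUnitCurrentPotential_iff_netCurrent G i j φ).2 ?_, rfl⟩
  convert h

/-- A connected network has a symmetric Green's function grounded at a given vertex `o`. -/
theorem exists_symmetric_green {V : Type*} [Fintype V] [DecidableEq V] {G : SimpleGraph V}
    (hG : G.Connected) (o : V) :
    ∃ g : V → V → ℝ, (∀ i j, g i j = g j i) ∧
      ∀ i, netCurrent G (g i) = Pi.single i 1 - Pi.single o 1 := by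
  have hex : ∀ i, ∃ φ : V → ℝ, netCurrent G φ = Pi.single i 1 - Pi.single o 1 := by
    intro i
    obtain ⟨r, ⟨φ, hφ, -⟩, -⟩ := existsUnique_isEffectiveResistance G hG i o
    refine ⟨φ, ?_⟩
    convert (isUnitCurrentPotential_iff_netCurrent G i o φ).1 hφ
  choose ψ hψ using hex
  -- Potentials are determined up to constants. Reciprocity gives `ψ i j - ψ i o = ψ j i - ψ j o`,
  -- so normalising to vanish at `o` makes them symmetric.
  refine ⟨fun i => ψ i - fun _ => ψ i o, fun i j => ?_, fun i => ?_⟩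
  · have h := dotProduct_netCurrent G (ψ i) (ψ j)
    rw [hψ, hψ] at h
    simpa [dotProduct_sub, sub_dotProduct] using h
  · rw [map_sub, netCurrent_const, sub_zero, hψ]

/-! ### Potentials on the parallel subdivision -/

/-- The average of a function over the two ends of an edge. -/
noncomputable def edgeAverage {V : Type*} (φ : V → ℝ) : Sym2 V → ℝ :=
  Sym2.lift ⟨fun a b => (φ a + φ b) / 2, fun a b => by ring⟩

@[simp]
theorem edgeAverage_mk {V : Type*} (φ : V → ℝ) (a b : V) :
    edgeAverage φ s(a, b) = (φ a + φ b) / 2 := rfl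

/-- The extension of a potential on `G` to the parallel subdivision, every new vertex being given
the average of the potentials at its neighbours. -/
noncomputable def subdivisionExtend {V : Type*} (G : SimpleGraph V) (k : ℕ) (φ : V → ℝ) :
    V ⊕ (G.edgeSet × Fin k) → ℝ :=
  Sum.elim φ fun n => edgeAverage φ n.1

section ParallelSubdivision

variable {V : Type*} {G : SimpleGraph V} {k : ℕ}

@[simp]
theorem parallelSubdivision_adj_inl_inl (v w : V) :
    ¬ (parallelSubdivision G k).Adj (Sum.inl v) (Sum.inl w) := id

@[simp]
theorem parallelSubdivision_adj_inr_inr (m n : G.edgeSet × Fin k) :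
    ¬ (parallelSubdivision G k).Adj (Sum.inr m) (Sum.inr n) := id

@[simp]
theorem parallelSubdivision_adj_inl_inr (v : V) (n : G.edgeSet × Fin k) :
    (parallelSubdivision G k).Adj (Sum.inl v) (Sum.inr n) ↔ v ∈ (n.1 : Sym2 V) := Iff.rfl

@[simp]
theorem parallelSubdivision_adj_inr_inl (n : G.edgeSet × Fin k) (v : V) :
    (parallelSubdivision G k).Adj (Sum.inr n) (Sum.inl v) ↔ v ∈ (n.1 : Sym2 V) := Iff.rfl

theorem edge_eq_of_neighborSet_inr {n : G.edgeSet × Fin k} {s t : V}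
    (h : (parallelSubdivision G k).neighborSet (Sum.inr n) = {Sum.inl s, Sum.inl t}) :
    (n.1 : Sym2 V) = s(s, t) := by
  refine Sym2.ext fun v => ?_
  have hv := Set.ext_iff.1 h (Sum.inl v)
  simpa using hv

theorem parallelSubdivision_connected (hG : G.Connected) (hk : 1 ≤ k) :
    (parallelSubdivision G k).Connected := by
  have hadj : ∀ v w, G.Adj v w →
      (parallelSubdivision G k).Reachable (Sum.inl v) (Sum.inl w) := by
    intro v w h
    -- Without a copy of each edge, that is for `k = 0`, old vertices would be isolated.
    let n : G.edgeSet × Fin k := (⟨s(v, w), h⟩, ⟨0, hk⟩)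
    have h₁ : (parallelSubdivision G k).Adj (Sum.inl v) (Sum.inr n) := Sym2.mem_mk_left v w
    have h₂ : (parallelSubdivision G k).Adj (Sum.inr n) (Sum.inl w) := Sym2.mem_mk_right v w
    exact h₁.reachable.trans h₂.reachable
  have hinl : ∀ v w, (parallelSubdivision G k).Reachable (Sum.inl v) (Sum.inl w) := by
    intro v w
    obtain ⟨p⟩ := hG.preconnected v w
    induction p with
    | nil => exact SimpleGraph.Reachable.refl _
    | cons h _ ih => exact (hadj _ _ h).trans ih
  obtain ⟨o⟩ := hG.nonempty
  refine SimpleGraph.connected_iff_exists_forall_reachable _ |>.2 ⟨Sum.inl o, ?_⟩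
  rintro (v | ⟨⟨e, he⟩, l⟩)
  · exact hinl o v
  · induction e with
    | h a b =>
      have h : (parallelSubdivision G k).Adj (Sum.inl a) (Sum.inr (⟨s(a, b), he⟩, l)) :=
        Sym2.mem_mk_left a b
      exact (hinl o a).trans h.reachable

variable [Fintype V] [DecidableEq V] [DecidableRel G.Adj]

/-- Summing over the edges at `v` is summing over the neighbours of `v`. -/
theorem sum_edgeSet_mem_eq_sum_adj (v : V) (f : Sym2 V → ℝ) :
    (∑ e : G.edgeSet, if v ∈ (e : Sym2 V) then f e else 0) =
      ∑ x : V, if G.Adj v x then f s(v, x) else 0 := by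
  rw [← Finset.sum_filter, ← Finset.sum_filter]
  symm
  refine Finset.sum_bij (fun x hx => ⟨s(v, x), (Finset.mem_filter.1 hx).2⟩) ?_ ?_ ?_ ?_
  · intro x hx
    simp
  · intro x hx y hy h
    exact Sym2.congr_right.1 (congrArg Subtype.val h)
  · rintro ⟨e, he⟩ hv
    obtain ⟨x, rfl⟩ := Sym2.mem_iff_exists.1 (Finset.mem_filter.1 hv).2
    exact ⟨x, Finset.mem_filter.2 ⟨Finset.mem_univ _, he⟩, rfl⟩
  · intro x hx
    rfl

theorem netCurrent_parallelSubdivision_inl (Φ : V ⊕ (G.edgeSet × Fin k) → ℝ) (v : V) :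
    netCurrent (parallelSubdivision G k) Φ (Sum.inl v) =
      ∑ n : G.edgeSet × Fin k,
        if v ∈ (n.1 : Sym2 V) then Φ (Sum.inl v) - Φ (Sum.inr n) else 0 := by
  rw [netCurrent_apply, Fintype.sum_sum_type]
  simp

theorem netCurrent_parallelSubdivision_inr (Φ : V ⊕ (G.edgeSet × Fin k) → ℝ)
    {n : G.edgeSet × Fin k} {s t : V} (h : (n.1 : Sym2 V) = s(s, t)) :
    netCurrent (parallelSubdivision G k) Φ (Sum.inr n) =
      2 * Φ (Sum.inr n) - Φ (Sum.inl s) - Φ (Sum.inl t) := by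
  have hst : s ≠ t := by
    have h' := n.1.2
    rw [h] at h'
    exact G.ne_of_adj h'
  have hfilter : Finset.univ.filter (fun x => x = s ∨ x = t) = {s, t} := by
    ext x
    simp
  rw [netCurrent_apply, Fintype.sum_sum_type]
  simp only [parallelSubdivision_adj_inr_inl, parallelSubdivision_adj_inr_inr, h, Sym2.mem_iff,
    if_false, Finset.sum_const_zero, add_zero]
  rw [← Finset.sum_filter]
  have : (∑ x : V with x = s ∨ x = t, (Φ (Sum.inr n) - Φ (Sum.inl x))) =
      2 * Φ (Sum.inr n) - Φ (Sum.inl s) - Φ (Sum.inl t) := by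
    rw [hfilter, Finset.sum_pair hst]
    ring
  convert this

/-- Along each of the `k` copies of an edge, the drop to the midpoint is half the drop across the
edge. -/
theorem netCurrent_subdivisionExtend (φ : V → ℝ) :
    netCurrent (parallelSubdivision G k) (subdivisionExtend G k φ) =
      Sum.elim ((k / 2 : ℝ) • netCurrent G φ) 0 := by
  ext (v | n)
  · have h := sum_edgeSet_mem_eq_sum_adj (G := G) v fun e => φ v - edgeAverage φ e
    rw [netCurrent_parallelSubdivision_inl, Fintype.sum_prod_type_right]
    simp only [subdivisionExtend, Sum.elim_inl, Sum.elim_inr]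
    rw [Finset.sum_congr rfl fun l _ => (by convert h), Finset.sum_const, Finset.card_univ, Fintype.card_fin, nsmul_eq_mul, Pi.smul_apply,
      netCurrent_apply, smul_eq_mul, Finset.mul_sum, Finset.mul_sum]
    refine Finset.sum_congr rfl fun x _ => ?_
    by_cases hx : G.Adj v x
    · simp only [hx, if_true, edgeAverage_mk]
      ring
    · simp [hx]
  · obtain ⟨⟨e, he⟩, l⟩ := n
    induction e with
    | h a b =>
      rw [netCurrent_parallelSubdivision_inr _ (s := a) (t := b) rfl]
      simp only [subdivisionExtend, Sum.elim_inl, Sum.elim_inr, edgeAverage_mk, Pi.zero_apply]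
      ring

/-- A new vertex has degree 2, so height `1 / 2` sends out a unit current, half of it to each end.
-/
theorem netCurrent_single_inr {n : G.edgeSet × Fin k} {s t : V} (h : (n.1 : Sym2 V) = s(s, t)) :
    netCurrent (parallelSubdivision G k) (Pi.single (Sum.inr n) (1 / 2)) =
      Pi.single (Sum.inr n) 1 - (1 / 2 : ℝ) • Pi.single (Sum.inl s) 1
        - (1 / 2 : ℝ) • Pi.single (Sum.inl t) 1 := by
  have hst : s ≠ t := by
    have h' := n.1.2
    rw [h] at h'
    exact G.ne_of_adj h'
  ext (v | m)
  · rw [netCurrent_parallelSubdivision_inl, Finset.sum_eq_single n]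
    · rw [h]
      by_cases hs : v = s
      · subst hs
        simp [hst]
      · by_cases ht : v = t
        · subst ht
          simp [hs]
        · simp [hs, ht]
    · intro m _ hm
      simp [hm]
    · simp
  · obtain ⟨⟨e, he⟩, l⟩ := m
    induction e with
    | h a b =>
      rw [netCurrent_parallelSubdivision_inr _ (s := a) (t := b) rfl]
      simp [Pi.single_apply]

/-- A Green's function of `G` grounded at `o` gives the potentials on the parallel subdivision of
a unit current from an old vertex to `o`. -/
theorem netCurrent_subdivisionExtend_green (hk : 1 ≤ k) {o i : V} {φ : V → ℝ}
    (hφ : netCurrent G φ = Pi.single i 1 - Pi.single o 1) :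
    netCurrent (parallelSubdivision G k) ((2 / k : ℝ) • subdivisionExtend G k φ) =
      Pi.single (Sum.inl i) 1 - Pi.single (Sum.inl o) 1 := by
  have hk' : (k : ℝ) ≠ 0 := by positivity
  rw [map_smul, netCurrent_subdivisionExtend, hφ]
  ext (v | n)
  · simp only [Pi.smul_apply, Sum.elim_inl, smul_eq_mul, Pi.sub_apply, Pi.single_apply,
      Sum.inl.injEq]
    field_simp
  · simp

/-- A Green's function of `G` grounded at `o` gives the potentials on the parallel subdivision of
a unit current from a new vertex to `o`. -/
theorem netCurrent_subdivisionExtend_green_inr (hk : 1 ≤ k) {o s t : V} {φ ψ : V → ℝ}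
    {n : G.edgeSet × Fin k} (h : (n.1 : Sym2 V) = s(s, t))
    (hφ : netCurrent G φ = Pi.single s 1 - Pi.single o 1)
    (hψ : netCurrent G ψ = Pi.single t 1 - Pi.single o 1) :
    netCurrent (parallelSubdivision G k)
        ((1 / 2 : ℝ) • ((2 / k : ℝ) • subdivisionExtend G k φ)
          + (1 / 2 : ℝ) • ((2 / k : ℝ) • subdivisionExtend G k ψ)
          + Pi.single (Sum.inr n) (1 / 2)) =
      Pi.single (Sum.inr n) 1 - Pi.single (Sum.inl o) 1 := by
  rw [map_add, map_add, map_smul _ (1 / 2 : ℝ), map_smul _ (1 / 2 : ℝ),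
    netCurrent_subdivisionExtend_green hk hφ, netCurrent_subdivisionExtend_green hk hψ,
    netCurrent_single_inr h]
  module

end ParallelSubdivision

theorem mainTheorem4 {V : Type*} [Fintype V] (G : SimpleGraph V)
    [DecidableRel G.Adj] (hG : G.Connected) (k : ℕ) (hk : 1 ≤ k) :
    (∀ i j : V,
      resistanceDist (parallelSubdivision G k) (Sum.inl i) (Sum.inl j) =
        (2 / (k : ℝ)) * resistanceDist G i j) ∧
    (∀ (i : G.edgeSet × Fin k) (j s t : V),
      (parallelSubdivision G k).neighborSet (Sum.inr i) = {Sum.inl s, Sum.inl t} →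
      resistanceDist (parallelSubdivision G k) (Sum.inr i) (Sum.inl j) =
        ((k : ℝ) + 2 * resistanceDist G s j + 2 * resistanceDist G t j - resistanceDist G s t) /
          (2 * (k : ℝ))) ∧
    (∀ (i j : G.edgeSet × Fin k) (s t p q : V), i ≠ j →
      (parallelSubdivision G k).neighborSet (Sum.inr i) = {Sum.inl s, Sum.inl t} →
      (parallelSubdivision G k).neighborSet (Sum.inr j) = {Sum.inl p, Sum.inl q} →
      resistanceDist (parallelSubdivision G k) (Sum.inr i) (Sum.inr j) =
        (2 * (k : ℝ) + resistanceDist G s p + resistanceDist G s q + resistanceDist G t p +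
            resistanceDist G t q - resistanceDist G p q - resistanceDist G s t) /
          (2 * (k : ℝ))) := by
  classical
  have hk' : (k : ℝ) ≠ 0 := by positivity
  obtain ⟨o⟩ := hG.nonempty
  obtain ⟨g, hsymm, hg⟩ := exists_symmetric_green hG o
  have hS := parallelSubdivision_connected hG hk
  have hΩ : ∀ i j, resistanceDist G i j = g i i + g j j - 2 * g i j := by
    intro i j
    rw [resistanceDist_eq_of_netCurrent hG (φ := g i - g j) (by rw [map_sub, hg, hg]; abel)]
    simp only [Pi.sub_apply, hsymm j i]
    ring
  refine ⟨fun i j => ?_, fun i j s t hi => ?_, fun i j s t p q hij hi hj => ?_⟩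
  · have h := (congrArg₂ (· - ·) (netCurrent_subdivisionExtend_green (k := k) hk (hg i))
      (netCurrent_subdivisionExtend_green (k := k) hk (hg j)))
    -- The two sinks at `o` cancel.
    rw [← map_sub, sub_sub_sub_cancel_right] at h
    rw [resistanceDist_eq_of_netCurrent hS h, hΩ]
    simp only [subdivisionExtend, Pi.sub_apply, Pi.smul_apply, smul_eq_mul, Sum.elim_inl,
      hsymm j i]
    ring
  · have hi' := edge_eq_of_neighborSet_inr hi
    have h := (congrArg₂ (· - ·) (netCurrent_subdivisionExtend_green_inr hk hi' (hg s) (hg t))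
      (netCurrent_subdivisionExtend_green (k := k) hk (hg j)))
    rw [← map_sub, sub_sub_sub_cancel_right] at h
    rw [resistanceDist_eq_of_netCurrent hS h]
    simp only [hΩ, subdivisionExtend, Pi.sub_apply, Pi.add_apply, Pi.smul_apply, smul_eq_mul,
      Sum.elim_inl, Sum.elim_inr, hi', edgeAverage_mk, Pi.single_apply, if_true, reduceCtorEq,
      if_false, hsymm t s, hsymm j s, hsymm j t]
    field_simp
    ring
  · have hi' := edge_eq_of_neighborSet_inr hi
    have hj' := edge_eq_of_neighborSet_inr hj
    have h := (congrArg₂ (· - ·) (netCurrent_subdivisionExtend_green_inr hk hi' (hg s) (hg t))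
      (netCurrent_subdivisionExtend_green_inr hk hj' (hg p) (hg q)))
    rw [← map_sub, sub_sub_sub_cancel_right] at h
    rw [resistanceDist_eq_of_netCurrent hS h]
    -- Since `i ≠ j`, neither spike is seen at the other vertex, and together they contribute `1 =
    -- 2k / (2k)`.
    simp only [hΩ, subdivisionExtend, Pi.sub_apply, Pi.add_apply, Pi.smul_apply, smul_eq_mul,
      Sum.elim_inr, hi', hj', edgeAverage_mk, Pi.single_apply, if_true, Sum.inr.injEq,
      hij, hij.symm, if_false, hsymm t s, hsymm q p, hsymm p s, hsymm p t, hsymm q s, hsymm q t]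
    field_simp
    ring
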